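/- Let $\overline{M}$ be a (locally small) symmetric monoidal closed category with all set-indexed products; write $I,\otimes,\multimap$ for its structure and $1$ for its terminal object. Let $\overline{\overline{M}}$ be its free coproduct completion: an object is a pair $A=(\sharp A,(A_x)_{x\in\sharp A})$ of a set and a family of objects of $\overline{M}$, and an arrow $A\to B$ is a function $f:\sharp A\to\sharp B$ with arrows $f_x:A_x\to B_{f(x)}$ ($x\in\sharp A$). Give $\overline{\overline{M}}$ the symmetric monoidal structure $A\otimes B=(\sharp A\times\sharp B,(A_x\otimes B_y)_{(x,y)})$, with unit $(1,(I))$. Let $\sharp:\overline{\overline{M}}\to\mathbf{Set}$ be the projection to index sets, and let $q,p:\mathbf{Set}\to\overline{\overline{M}}$ be the functors $qX=(X,(1)_{x\in X})$, $pX=(X,(I)_{x\in X})$. Then $\overline{\overline{M}}$ is monoidal closed, with $A\multimap B\cong\big(\sharp B^{\sharp A},(\prod_{x\in\sharp A}(A_x\multimap B_{f(x)}))_{f:\sharp A\to\sharp B}\big)$, and $\sharp$ is a state-parameter fibration with parameterized-terminal functor $q$ and parameterized-unit functor $p$. Explicitly, where an arrow $f:Y\to X$ is called cartesian if every $g:Z\to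 X$ with a factorization $\sharp g=\sharp f\circ b$ factors uniquely as $g=f\circ u$ with $\sharp u=b$: 1. $\sharp$ is a pullback fibration: it is a Grothendieck fibration, $\mathbf{Set}$ has pullbacks, both categories have terminal objects, and $\sharp$ preserves the terminal object. Moreover $\mathbf{Set}$ is locally cartesian closed. 2. $q$ is a strict section of $\sharp$ ($\sharp q=\mathrm{id}$) that sends all arrows to cartesian arrows and $1$ to a terminal object, and it is a full and faithful right adjoint of $\sharp$ with identity counit. Likewise $p$ is a strict section of $\sharp$ that sends all arrows to cartesian arrows and $1$ to (an object isomorphic to) the monoidal unit. 3. $\sharp$ preserves the symmetric monoidal closed structure: it sends $I,\otimes,\multimap$ to $1,\times$ and the exponentials of $\mathbf{Set}$. 4. If $f$ and $g$ are cartesian, so is $f\otimes g$. 5. For every set $X$, the slice $\overline{\overline{M}}/qX$ is symmetric monoidal closed for the fibered tensor product: $A\otimes_{qX}B$ is the domain of a cartesian arrow $j$ to $A\otimes B$ lying over the inclusion $\sharp A\times_X\sharp B\hookrightarrow\sharp A\times\sharp B$, the unit is the domain of a cartesian arrow to the unit of $\overline{\overline{M}}$, and these arrows are compatible with the structure isomorphisms.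 The functor $-\otimes_{qX}A$ has a right adjoint $A\multimap_{qX}-$, and the induced functor $\overline{\overline{M}}/qX\to\mathbf{Set}/X$ preserves the symmetric monoidal closed structure (tensor products go to fiber products over $X$, internal homs to exponentials of $\mathbf{Set}/X$). 6. $p$ has a right adjoint $\flat$. -/

import Mathlib

open CategoryTheory Limits MonoidalCategory

universe v₁ v₂ u₁ u₂ v u

namespace StateParameter

section General

variable {E : Type u₁} [Category.{v₁} E] {B : Type u₂} [Category.{v₂} B]

/-- An arrow `f : Y ⟶ X` of the total category is cartesian if every `g : Z ⟶ X` together with a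
factorization `F g = b ≫ F f` in the base factors uniquely as `u ≫ f` with `F u = b`. -/
def IsCartesianArrow (F : E ⥤ B) {Y X : E} (f : Y ⟶ X) : Prop :=
  F.IsStronglyCartesian (F.map f) f

/-- A pullback fibration: a Grothendieck fibration whose base has pullbacks and a terminal object,
whose total category has a terminal object, and which preserves the terminal object. -/
structure IsPullbackFibration (F : E ⥤ B) : Prop where
  isFibered : F.IsFibered
  hasPullbacks : HasPullbacks B
  hasTerminal_base : HasTerminal B
  hasTerminal_total : HasTerminal E
  preservesTerminal : PreservesLimit (Functor.empty.{0} E) F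

/-- `s` is a strict section of `F` made of cartesian arrows (so `s X` is the reindexing of `s 1`
along `X ⟶ 1`). -/
structure IsCartesianSection (F : E ⥤ B) (s : B ⥤ E) : Prop where
  comp_eq : s ⋙ F = 𝟭 B
  cartesian : ∀ ⦃Y X : B⦄ (f : Y ⟶ X), IsCartesianArrow F (s.map f)

/-- The parameterized-terminal functor `q`: cartesian liftings of the arrows of the base, with
`q 1` terminal. It is a fully faithful right adjoint of `F` whose counit is the identity. -/
structure IsParameterizedTerminal (F : E ⥤ B) (q : B ⥤ E) [CartesianMonoidalCategory B] : Prop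
    extends IsCartesianSection F q where
  terminal : Nonempty (IsTerminal (q.obj (𝟙_ B)))
  full : q.Full
  faithful : q.Faithful
  adjunction : ∃ adj : F ⊣ q, ∀ X : B,
    adj.counit.app X = eqToHom (Functor.congr_obj comp_eq X)

/-- The parameterized-unit functor `p`: cartesian liftings of the arrows of the base, with
`p 1` the monoidal unit. -/
structure IsParameterizedUnit (F : E ⥤ B) (p : B ⥤ E) [CartesianMonoidalCategory B]
    [MonoidalCategory E] : Prop extends IsCartesianSection F p where
  unit : Nonempty (p.obj (𝟙_ B) ≅ 𝟙_ E)

/-- A monoidal functor `F` preserves internal homs: for all `X` and `Y`, the object `F (X ⊸ Y)`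
with the image of the evaluation `X ⊗ (X ⊸ Y) ⟶ Y` is an internal hom from `F X` to `F Y`. -/
def PreservesInternalHom [MonoidalCategory E] [MonoidalClosed E] [MonoidalCategory B]
    (F : E ⥤ B) [F.LaxMonoidal] : Prop :=
  ∀ (X Y : E) (Z : B), Function.Bijective fun g : Z ⟶ F.obj ((ihom X).obj Y) =>
    F.obj X ◁ g ≫ Functor.LaxMonoidal.μ F X ((ihom X).obj Y) ≫ F.map ((ihom.ev X).app Y)

attribute [local instance] Over.cartesianMonoidalCategory Over.braidedCategory

/-- A locally cartesian closed category: there is a terminal object, and every slice, with the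
cartesian monoidal structure given by pullbacks, is cartesian closed. -/
def IsLocallyCartesianClosed (B : Type u₂) [Category.{v₂} B] [HasPullbacks B] : Prop :=
  HasTerminal B ∧ ∀ X : B, Nonempty (MonoidalClosed (Over X))

/-- The fibered symmetric monoidal closed structure on the slice `E / Q`, where `Q = q X`.
The tensor product `A ⊗_Q A'` comes with a cartesian arrow `j` to `A ⊗ A'` that lies over the
canonical inclusion of the fiber product `F A ×_X F A'` in `F A × F A'`, and the unit with a
cartesian arrow to the unit of `E`; these arrows are compatible with all the structure
isomorphisms. There are internal homs `A ⊸_Q A'`, right adjoint to the tensor product, and they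
lie over the exponentials of the slice of the base. -/
structure FiberedMonoidalClosed [MonoidalCategory E] [SymmetricCategory E]
    [CartesianMonoidalCategory B] [BraidedCategory B] [HasPullbacks B]
    (F : E ⥤ B) [F.Braided] (Q : E) where
  monoidal : MonoidalCategory (Over Q)
  symmetric : SymmetricCategory (Over Q)
  closed : MonoidalClosed (Over Q)
  /-- The arrows `j = δ : (A ⊗_Q A').left ⟶ A.left ⊗ A'.left` and `η : (𝟙_Q).left ⟶ 𝟙`. -/
  forget : (Over.forget Q).OplaxMonoidal
  forget_braiding : ∀ A A' : Over Q,
    (β_ A A').hom.left ≫ Functor.OplaxMonoidal.δ (Over.forget Q) A' A =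
      Functor.OplaxMonoidal.δ (Over.forget Q) A A' ≫ (β_ A.left A'.left).hom
  δ_cartesian : ∀ A A' : Over Q,
    IsCartesianArrow F (Functor.OplaxMonoidal.δ (Over.forget Q) A A')
  η_cartesian : IsCartesianArrow F (Functor.OplaxMonoidal.η (Over.forget Q))
  /-- The functor `E / Q ⥤ B / F Q` is symmetric strong monoidal. -/
  post : (Over.post F : Over Q ⥤ Over (F.obj Q)).Braided
  /-- `F j` is the canonical inclusion of the fiber product in the product. -/
  map_δ : ∀ A A' : Over Q,
    F.map (Functor.OplaxMonoidal.δ (Over.forget Q) A A') ≫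
        Functor.OplaxMonoidal.δ F A.left A'.left =
      (Functor.OplaxMonoidal.δ (Over.post F : Over Q ⥤ Over (F.obj Q)) A A').left ≫
        CartesianMonoidalCategory.lift
          (pullback.fst (F.map A.hom) (F.map A'.hom)) (pullback.snd (F.map A.hom) (F.map A'.hom))
  preservesInternalHom : PreservesInternalHom (Over.post F : Over Q ⥤ Over (F.obj Q))

/-- `F : E ⥤ B` is a state-parameter fibration, with parameterized-terminal functor `q` and
parameterized-unit functor `p`. Here `E` is symmetric monoidal closed, `B` has its cartesian
monoidal structure, and `F` is symmetric strong monoidal. -/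
structure IsStateParameterFibration [MonoidalCategory E] [SymmetricCategory E] [MonoidalClosed E]
    [CartesianMonoidalCategory B] [BraidedCategory B] [HasPullbacks B]
    (F : E ⥤ B) [F.Braided] (q p : B ⥤ E) : Prop where
  isPullbackFibration : IsPullbackFibration F
  isLocallyCartesianClosed : IsLocallyCartesianClosed B
  isParameterizedTerminal : IsParameterizedTerminal F q
  isParameterizedUnit : IsParameterizedUnit F p
  preservesInternalHom : PreservesInternalHom F
  tensor_cartesian : ∀ {Y X Y' X' : E} (f : Y ⟶ X) (g : Y' ⟶ X'),
    IsCartesianArrow F f → IsCartesianArrow F g → IsCartesianArrow F (f ⊗ₘ g)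
  fiberedMonoidalClosed : ∀ X : B, Nonempty (FiberedMonoidalClosed F (q.obj X))
  /-- The right adjoint of `p` is `♭`. -/
  isLeftAdjoint : p.IsLeftAdjoint

end General

section Families

variable (M : Type u) [Category.{v} M]

/-- The category of families of objects of `M` indexed by small sets, i.e. the free coproduct
completion of `M`. -/
abbrev Fam : Type (max u (v + 1)) := FormalCoproduct.{v} M

/-- The functor `♯` that sends a family to its index set. -/
@[simps]
def sharp : Fam.{v} M ⥤ Type v where
  obj A := A.I
  map f := ↾f.f

theorem hasTerminal_of_hasProducts [HasProducts.{v} M] : HasTerminal M :=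
  haveI : HasFiniteProducts M := hasFiniteProducts_of_hasProducts.{v} M
  inferInstance

/-- The functor `X ↦ (X, (1)_{x ∈ X})`, where `1` is the terminal object of `M`. -/
noncomputable def paramTerminal [HasProducts.{v} M] : Type v ⥤ Fam.{v} M where
  obj X := ⟨X, fun _ => haveI := hasTerminal_of_hasProducts M; ⊤_ M⟩
  map f := ⟨f, fun _ => 𝟙 _⟩

variable [MonoidalCategory M]

/-- The functor `X ↦ (X, (I)_{x ∈ X})`. -/
@[simps]
def paramUnit : Type v ⥤ Fam.{v} M where
  obj X := ⟨X, fun _ => 𝟙_ M⟩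
  map f := ⟨f, fun _ => 𝟙 _⟩

@[simps]
instance famMonoidalStruct : MonoidalCategoryStruct.{v, max u (v + 1)} (Fam.{v} M) where
  tensorObj A B := ⟨A.I × B.I, fun i => A.obj i.1 ⊗ B.obj i.2⟩
  tensorUnit := ⟨PUnit, fun _ => 𝟙_ M⟩
  whiskerLeft A _ _ g := ⟨fun i => (i.1, g.f i.2), fun i => A.obj i.1 ◁ g.φ i.2⟩
  whiskerRight f B := ⟨fun i => (f.f i.1, i.2), fun i => f.φ i.1 ▷ B.obj i.2⟩
  tensorHom f g := ⟨fun i => (f.f i.1, g.f i.2), fun i => f.φ i.1 ⊗ₘ g.φ i.2⟩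
  associator A B C :=
    { hom := ⟨fun i => (i.1.1, (i.1.2, i.2)),
        fun i => (α_ (A.obj i.1.1) (B.obj i.1.2) (C.obj i.2)).hom⟩
      inv := ⟨fun i => ((i.1, i.2.1), i.2.2),
        fun i => (α_ (A.obj i.1) (B.obj i.2.1) (C.obj i.2.2)).inv⟩
      hom_inv_id := FormalCoproduct.hom_ext rfl (by intro i; simp)
      inv_hom_id := FormalCoproduct.hom_ext rfl (by intro i; simp) }
  leftUnitor A :=
    { hom := ⟨fun i => i.2, fun i => (λ_ (A.obj i.2)).hom⟩
      inv := ⟨fun i => (PUnit.unit, i), fun i => (λ_ (A.obj i)).inv⟩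
      hom_inv_id := FormalCoproduct.hom_ext rfl (by intro i; simp)
      inv_hom_id := FormalCoproduct.hom_ext rfl (by intro i; simp) }
  rightUnitor A :=
    { hom := ⟨fun i => i.1, fun i => (ρ_ (A.obj i.1)).hom⟩
      inv := ⟨fun i => (i, PUnit.unit), fun i => (ρ_ (A.obj i)).inv⟩
      hom_inv_id := FormalCoproduct.hom_ext rfl (by intro i; simp)
      inv_hom_id := FormalCoproduct.hom_ext rfl (by intro i; simp) }

instance famMonoidal : MonoidalCategory.{v, max u (v + 1)} (Fam.{v} M) where
  tensorHom_def _ _ := FormalCoproduct.hom_ext rfl (by intro i; simp [MonoidalCategory.tensorHom_def])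
  id_tensorHom_id _ _ := FormalCoproduct.hom_ext rfl (by intro i; simp)
  tensorHom_comp_tensorHom _ _ _ _ := FormalCoproduct.hom_ext rfl (by intro i; simp)
  whiskerLeft_id _ _ := FormalCoproduct.hom_ext rfl (by intro i; simp)
  id_whiskerRight _ _ := FormalCoproduct.hom_ext rfl (by intro i; simp)
  associator_naturality _ _ _ := FormalCoproduct.hom_ext rfl (by intro i; simp)
  leftUnitor_naturality _ := FormalCoproduct.hom_ext rfl (by intro i; simp)
  rightUnitor_naturality _ := FormalCoproduct.hom_ext rfl (by intro i; simp)
  pentagon _ _ _ _ := FormalCoproduct.hom_ext rfl (by intro i; simp)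
  triangle _ _ := FormalCoproduct.hom_ext rfl (by intro i; simp)

instance famSymmetric [SymmetricCategory M] : SymmetricCategory.{v, max u (v + 1)} (Fam.{v} M) where
  braiding A B :=
    { hom := ⟨fun i => (i.2, i.1), fun i => (β_ (A.obj i.1) (B.obj i.2)).hom⟩
      inv := ⟨fun i => (i.2, i.1), fun i => (β_ (A.obj i.2) (B.obj i.1)).inv⟩
      hom_inv_id := FormalCoproduct.hom_ext rfl (by intro i; simp)
      inv_hom_id := FormalCoproduct.hom_ext rfl (by intro i; simp) }
  braiding_naturality_right _ _ _ _ := FormalCoproduct.hom_ext rfl (by intro i; simp)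
  braiding_naturality_left _ _ := FormalCoproduct.hom_ext rfl (by intro i; simp)
  hexagon_forward _ _ _ := FormalCoproduct.hom_ext rfl (by intro i; simp)
  hexagon_reverse _ _ _ := FormalCoproduct.hom_ext rfl (by intro i; simp)
  symmetry _ _ := FormalCoproduct.hom_ext rfl (by intro i; simp)

/-- `♯` strictly sends `⊗` to `×` and the unit to the one-point set. -/
instance sharpMonoidal : (sharp M).Monoidal where
  ε := 𝟙 _
  μ _ _ := 𝟙 _
  η := 𝟙 _
  δ _ _ := 𝟙 _

instance sharpBraided [SymmetricCategory M] : (sharp M).Braided where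
  braided _ _ := rfl

/-- The family `A ⊸ B`: the index set is the set of functions `f` from the indices of `A` to those
of `B`, and the object at `f` is the product over `x` of the objects `A x ⊸ B (f x)`. -/
noncomputable def famHom {M : Type u} [Category.{v} M] [MonoidalCategory M] [MonoidalClosed M]
    [HasProducts.{v} M] (A B : Fam.{v} M) : Fam.{v} M :=
  ⟨A.I → B.I, fun f => ∏ᶜ fun x => (ihom (A.obj x)).obj (B.obj (f x))⟩

end Families

end StateParameter

namespace StateParameter

/-! ### Arrows of families and cartesian arrows -/

section Families

variable {M : Type u} [Category.{v} M]

/-! Everything is computed on indices and on components. An arrow of families is cartesian exactly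
when its components are isomorphisms (`isCartesianArrow_iff`); this yields the fibration, the
cartesian sections and the stability under `⊗`. Components into `1` are unique, so arrows to `q X`
are functions to `X`, and an object over `q X` is a family whose index set maps to `X`.

For closedness, an arrow `A ⊗ C ⟶ B` is a function of two indices with arrows `A a ⊗ C c ⟶ B (f (a,
c))`. For fixed `c`, these curry into a product over `a` (`piCurry`). In the slice, `a` runs through
the fibre over the base point of `c`, and internal homs are indexed by a point of `X` and a function
between fibres (`sliceHomEquiv`).

The functor to sets over `X` is compared with the abstract pullbacks only through projections. It
preserves internal homs by fibrewise currying (`preservesInternalHom_slicePost`). As every set over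
`X` underlies a family of units, exponentials of sets over `X` follow as well. -/

/-- The type of a component depends on the index function; pairing the two avoids transport along an
equality of indices. -/
theorem fam_hom_ext_sigma {A B : Fam.{v} M} {f g : A ⟶ B}
    (h : ∀ i, (⟨f.f i, f.φ i⟩ : Σ j, A.obj i ⟶ B.obj j) = ⟨g.f i, g.φ i⟩) : f = g := by
  obtain ⟨f, F⟩ := f
  obtain ⟨g, G⟩ := g
  obtain rfl : f = g := funext fun i => congrArg Sigma.fst (h i)
  obtain rfl : F = G := funext fun i => eq_of_heq (Sigma.mk.inj (h i)).2
  rfl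

theorem fam_sigma_eq {A B : Fam.{v} M} {f g : A ⟶ B} (h : f = g) (i : A.I) :
    (⟨f.f i, f.φ i⟩ : Σ j, A.obj i ⟶ B.obj j) = ⟨g.f i, g.φ i⟩ := by rw [h]

theorem fam_hom_ext {A B : Fam.{v} M} {f g : A ⟶ B} (h₁ : ∀ i, f.f i = g.f i)
    (h₂ : ∀ i, f.φ i ≍ g.φ i) : f = g :=
  fam_hom_ext_sigma fun i => Sigma.ext (h₁ i) (h₂ i)

theorem isHomLift_sharp_iff {A B : Fam.{v} M} (f : (sharp M).obj A ⟶ (sharp M).obj B) (φ : A ⟶ B) :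
    (sharp M).IsHomLift f φ ↔ φ.f = f := by
  constructor
  · intro h
    exact congrArg (fun k : A.I ⟶ B.I => (k : A.I → B.I))
      (IsHomLift.eq_of_isHomLift (sharp M) f φ).symm
  · intro h
    obtain rfl : f = (sharp M).map φ := by
      ext x
      exact (congrFun h x).symm
    infer_instance

theorem isCartesianArrow_iff_existsUnique {A B : Fam.{v} M} (f : A ⟶ B) :
    IsCartesianArrow (sharp M) f ↔ ∀ (Z : Fam.{v} M) (b : Z.I → A.I) (g : Z ⟶ B),
      g.f = f.f ∘ b → ∃! u : Z ⟶ A, u.f = b ∧ u ≫ f = g := by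
  constructor
  · intro h Z b g hg
    have hg' : (sharp M).IsHomLift
        ((↾b : (sharp M).obj Z ⟶ (sharp M).obj A) ≫ (sharp M).map f) g :=
      (isHomLift_sharp_iff _ _).2 hg
    have := h.universal_property' (↾b : (sharp M).obj Z ⟶ (sharp M).obj A) g
    simp only [isHomLift_sharp_iff] at this
    exact this
  · intro h
    refine { universal_property' := fun {Z} b g hg => ?_ }
    simpa only [isHomLift_sharp_iff] using h Z b g ((isHomLift_sharp_iff _ _).1 hg)

/-- A factorization through `f` over a given `b` solves `u z ≫ f.φ (b z) = g z` componentwise, which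
is uniquely possible for all `g` precisely when the `f.φ i` are invertible. -/
theorem isCartesianArrow_iff {A B : Fam.{v} M} (f : A ⟶ B) :
    IsCartesianArrow (sharp M) f ↔ ∀ i, IsIso (f.φ i) := by
  rw [isCartesianArrow_iff_existsUnique]
  constructor
  · intro h
    -- The reindexing of `B` along `f.f`: lifting its arrow with identity components gives
    -- right-sided cancellation `φ i ≫ f.φ i = 𝟙`; uniqueness, applied to `f` itself, gives the
    -- other composite.
    let Z : Fam.{v} M := ⟨A.I, fun i => B.obj (f.f i)⟩
    obtain ⟨⟨u, φ⟩, ⟨h₁, h₂⟩, -⟩ := h Z id ⟨f.f, fun i => 𝟙 _⟩ rfl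
    obtain rfl : u = id := h₁
    have h₃ : ∀ i, φ i ≫ f.φ i = 𝟙 _ := fun i =>
      eq_of_heq (Sigma.mk.inj (fam_sigma_eq h₂ i)).2
    have hk : (⟨id, fun i => f.φ i ≫ φ i⟩ : A ⟶ A) = 𝟙 A := by
      refine (h A id f rfl).unique ⟨rfl, fam_hom_ext (fun _ => rfl) fun i => heq_of_eq ?_⟩
        ⟨rfl, Category.id_comp _⟩
      change (f.φ i ≫ φ i) ≫ f.φ i = f.φ i
      rw [Category.assoc, h₃]
      exact Category.comp_id _
    exact fun i => ⟨φ i, eq_of_heq (Sigma.mk.inj (fam_sigma_eq hk i)).2, h₃ i⟩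
  · rintro h Z b ⟨g, γ⟩ rfl
    refine ⟨⟨b, fun z => γ z ≫ inv (f.φ (b z))⟩,
      ⟨rfl, fam_hom_ext (fun _ => rfl) fun i => heq_of_eq ?_⟩, ?_⟩
    · exact (Category.assoc _ _ _).trans (by rw [IsIso.inv_hom_id]; exact Category.comp_id _)
    · rintro ⟨u, υ⟩ ⟨rfl, h₂⟩
      refine fam_hom_ext (fun _ => rfl) fun i => heq_of_eq ?_
      exact (IsIso.eq_comp_inv _).2 (eq_of_heq (Sigma.mk.inj (fam_sigma_eq h₂ i)).2)

theorem isFibered_sharp : (sharp M).IsFibered :=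
  Functor.IsFibered.of_exists_isStronglyCartesian fun A R f =>
    ⟨⟨R, fun r => A.obj (f r)⟩, ⟨f, fun _ => 𝟙 _⟩,
      (isCartesianArrow_iff (A := ⟨R, fun r => A.obj (f r)⟩) ⟨f, fun _ => 𝟙 _⟩).2
        fun _ => inferInstanceAs (IsIso (𝟙 _))⟩

/-! ### The parameterized terminal object -/

section Terminal

variable [HasProducts.{v} M]

theorem hom_paramTerminal_ext {A : Fam.{v} M} {X : Type v} {f g : A ⟶ (paramTerminal M).obj X}
    (h : f.f = g.f) : f = g := by
  have := hasTerminal_of_hasProducts M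
  obtain ⟨f, F⟩ := f
  obtain ⟨g, G⟩ := g
  obtain rfl : f = g := h
  obtain rfl : F = G := funext fun i => (terminalIsTerminal (C := M)).hom_ext _ _
  rfl

/-- The arrow into `q X` over a given function. -/
noncomputable def homToParamTerminal {A : Fam.{v} M} {X : Type v} (f : A.I → X) :
    A ⟶ (paramTerminal M).obj X :=
  ⟨f, fun _ => haveI := hasTerminal_of_hasProducts M; terminal.from _⟩

/-- The functor `q` is right adjoint to `♯`. -/
noncomputable def sharpAdjunction : sharp M ⊣ paramTerminal M :=
  Adjunction.mkOfHomEquiv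
    { homEquiv _ _ :=
        { toFun f := homToParamTerminal f
          invFun g := ↾g.f
          left_inv _ := rfl
          right_inv _ := hom_paramTerminal_ext rfl }
      homEquiv_naturality_left_symm _ _ := rfl
      homEquiv_naturality_right _ _ := hom_paramTerminal_ext rfl }

theorem isCartesianSection_paramTerminal : IsCartesianSection (sharp M) (paramTerminal M) where
  comp_eq := rfl
  cartesian _ _ _ := (isCartesianArrow_iff _).2 fun _ => inferInstanceAs (IsIso (𝟙 _))

theorem isParameterizedTerminal_paramTerminal :
    IsParameterizedTerminal (sharp M) (paramTerminal M) where
  __ := isCartesianSection_paramTerminal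
  terminal := ⟨IsTerminal.ofUniqueHom (fun _ => homToParamTerminal fun _ => PUnit.unit)
    fun _ _ => hom_paramTerminal_ext rfl⟩
  full := ⟨fun f => ⟨↾f.f, hom_paramTerminal_ext rfl⟩⟩
  faithful := ⟨fun {_ _ f g} h => by
    ext x
    exact congrFun (congrArg FormalCoproduct.Hom.f h) x⟩
  -- The inverse hom bijection only forgets components, so the counit is the identity on the nose.
  adjunction := ⟨sharpAdjunction, fun X => rfl⟩

theorem isPullbackFibration_sharp : IsPullbackFibration (sharp M) where
  isFibered := isFibered_sharp
  hasPullbacks := inferInstance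
  hasTerminal_base := inferInstance
  hasTerminal_total :=
    (isParameterizedTerminal_paramTerminal (M := M)).terminal.some.hasTerminal
  preservesTerminal := by
    have t := (isParameterizedTerminal_paramTerminal (M := M)).terminal.some
    exact preservesLimit_of_preserves_limit_cone t
      ((isLimitMapConeEmptyConeEquiv (sharp M) _).symm
        (Types.isTerminalPUnit : IsTerminal (PUnit.{v + 1} : Type v)))

end Terminal

/-! ### The parameterized unit and the closed structure on families -/

section Monoidal

variable [MonoidalCategory M]

theorem isCartesianSection_paramUnit : IsCartesianSection (sharp M) (paramUnit M) where
  comp_eq := rfl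
  cartesian _ _ _ := (isCartesianArrow_iff _).2 fun _ => inferInstanceAs (IsIso (𝟙 _))

theorem isParameterizedUnit_paramUnit : IsParameterizedUnit (sharp M) (paramUnit M) where
  __ := isCartesianSection_paramUnit
  unit := ⟨Iso.refl _⟩

theorem tensor_isCartesianArrow {A B A' B' : Fam.{v} M} (f : A ⟶ B) (g : A' ⟶ B')
    (hf : IsCartesianArrow (sharp M) f) (hg : IsCartesianArrow (sharp M) g) :
    IsCartesianArrow (sharp M) (f ⊗ₘ g) := by
  rw [isCartesianArrow_iff] at hf hg ⊢
  intro i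
  have := hf i.1
  have := hg i.2
  exact inferInstanceAs (IsIso (f.φ i.1 ⊗ₘ g.φ i.2))

/-- Arrows out of `p X` are families of generalized elements of the target. -/
def paramUnitHomEquiv (X : Type v) (A : Fam.{v} M) :
    ((paramUnit M).obj X ⟶ A) ≃ (X ⟶ Σ i : A.I, 𝟙_ M ⟶ A.obj i) where
  toFun f := ↾fun x => ⟨f.f x, f.φ x⟩
  invFun g := ⟨fun x => (g x).1, fun x => (g x).2⟩
  left_inv _ := rfl
  right_inv _ := rfl

/-- The right adjoint sends `A` to the set of pairs of an index `i` and an arrow `𝟙_ M ⟶ A.obj i`;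
it is small because `M` is locally small. -/
theorem isLeftAdjoint_paramUnit : (paramUnit M).IsLeftAdjoint :=
  (Adjunction.adjunctionOfEquivRight paramUnitHomEquiv fun X' X A f g => by
    refine ConcreteCategory.hom_ext _ _ fun x => ?_
    apply Sigma.ext
    · rfl
    · exact heq_of_eq <| Category.id_comp (g.φ (f x))).isLeftAdjoint

variable [MonoidalClosed M] [HasProducts.{v} M]

/-- Currying componentwise, into a product of internal homs. -/
noncomputable def piCurry {J : Type v} (A B : J → M) (C : M) :
    (∀ j, A j ⊗ C ⟶ B j) ≃ (C ⟶ ∏ᶜ fun j => (ihom (A j)).obj (B j)) where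
  toFun f := Pi.lift fun j => MonoidalClosed.curry (f j)
  invFun g j := MonoidalClosed.uncurry (g ≫ Pi.π (fun j => (ihom (A j)).obj (B j)) j)
  left_inv f := by simp
  right_inv g := Pi.hom_ext _ _ fun b => by simp

theorem piCurry_naturality {J : Type v} (A B : J → M) {C' C : M} (f : C' ⟶ C)
    (g : ∀ j, A j ⊗ C ⟶ B j) :
    piCurry A B C' (fun j => A j ◁ f ≫ g j) = f ≫ piCurry A B C g :=
  Pi.hom_ext _ _ fun b => by simp [piCurry, MonoidalClosed.curry_natural_left]

theorem piCurry_symm_naturality {J : Type v} (A B : J → M) {C' C : M} (f : C' ⟶ C)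
    (g : C ⟶ ∏ᶜ fun j => (ihom (A j)).obj (B j)) (j : J) :
    (piCurry A B C').symm (f ≫ g) j = A j ◁ f ≫ (piCurry A B C).symm g j := by
  simp [piCurry, MonoidalClosed.uncurry_natural_left]

/-- Currying for families. -/
noncomputable def famHomEquiv (A C B : Fam.{v} M) :
    ((tensorLeft A).obj C ⟶ B) ≃ (C ⟶ famHom A B) where
  toFun f := ⟨fun c a => f.f (a, c), fun c =>
    piCurry A.obj (fun a => B.obj (f.f (a, c))) _ fun a => f.φ (a, c)⟩
  invFun g := ⟨fun i => g.f i.2 i.1,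
    fun i => (piCurry A.obj (fun a => B.obj (g.f i.2 a)) _).symm (g.φ i.2) i.1⟩
  left_inv f := fam_hom_ext (fun _ => rfl) fun i =>
    heq_of_eq (congrFun ((piCurry A.obj (fun a => B.obj (f.f (a, i.2))) (C.obj i.2)).symm_apply_apply
      (fun a => f.φ (a, i.2) : ∀ a, A.obj a ⊗ C.obj i.2 ⟶ B.obj (f.f (a, i.2)))) i.1)
  right_inv g := fam_hom_ext (fun _ => rfl) fun i =>
    heq_of_eq ((piCurry A.obj (fun a => B.obj (g.f i a)) _).apply_symm_apply (g.φ i))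

theorem famHomEquiv_naturality (A : Fam.{v} M) (C' C B : Fam.{v} M) (f : C' ⟶ C)
    (g : (tensorLeft A).obj C ⟶ B) :
    famHomEquiv A C' B ((tensorLeft A).map f ≫ g) = f ≫ famHomEquiv A C B g :=
  fam_hom_ext (fun _ => rfl) fun i =>
    heq_of_eq (piCurry_naturality A.obj _ (f.φ i) fun a => g.φ (a, f.f i))

/-- The closed structure of the category of families, with internal homs `famHom`. -/
@[reducible]
noncomputable def famClosed : MonoidalClosed (Fam.{v} M) where
  closed A := ⟨_, Adjunction.adjunctionOfEquivRight (famHomEquiv A) (famHomEquiv_naturality A)⟩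

/-- On indices, `μ` is the identity and evaluation is application, so the map in question is
ordinary uncurrying of functions. -/
theorem preservesInternalHom_sharp :
    letI := famClosed (M := M)
    PreservesInternalHom (sharp M) := by
  intro A B Z
  refine ⟨fun g g' h => ?_, fun k => ⟨↾fun z a => k (a, z), rfl⟩⟩
  ext z
  funext a
  exact congrFun (congrArg (fun k : (A.I × Z : Type v) ⟶ B.I => (k : A.I × Z → B.I)) h) (a, z)

end Monoidal

end Families

/-! ### The fibered symmetric monoidal closed structure over `q X` -/

section Slice

variable {M : Type u} [Category.{v} M] [HasProducts.{v} M] {X : Type v}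

/-- The function to `X` underlying a family over `q X`. -/
noncomputable def base (A : Over ((paramTerminal M).obj X)) : A.left.I → X := A.hom.f

theorem base_left {A B : Over ((paramTerminal M).obj X)} (f : A ⟶ B) (i : A.left.I) :
    base B (f.left.f i) = base A i :=
  congrFun (congrArg FormalCoproduct.Hom.f (Over.w f)) i

/-- The object over `q X` given by a family and a function from its index set to `X`. -/
noncomputable abbrev overMk (A : Fam.{v} M) (f : A.I → X) : Over ((paramTerminal M).obj X) :=
  Over.mk (homToParamTerminal f)

/-- An arrow over `q X` given by an arrow of families that is compatible with the functions
to `X`. -/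
noncomputable def overHom {A B : Over ((paramTerminal M).obj X)} (f : A.left ⟶ B.left)
    (h : ∀ i, base B (f.f i) = base A i) : A ⟶ B :=
  Over.homMk f (hom_paramTerminal_ext (funext h))

theorem over_hom_ext {A B : Over ((paramTerminal M).obj X)} {f g : A ⟶ B}
    (h₁ : ∀ i, f.left.f i = g.left.f i) (h₂ : ∀ i, f.left.φ i ≍ g.left.φ i) : f = g :=
  Over.OverMorphism.ext (fam_hom_ext h₁ h₂)

/-- An isomorphism over `q X` with a given index bijection. -/
noncomputable def overIso {A B : Over ((paramTerminal M).obj X)}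
    (f : A.left ⟶ B.left) (g : B.left ⟶ A.left)
    (h : ∀ i, base B (f.f i) = base A i) (h' : ∀ i, base A (g.f i) = base B i)
    (hfg : f ≫ g = 𝟙 _) (hgf : g ≫ f = 𝟙 _) : A ≅ B where
  hom := overHom f h
  inv := overHom g h'
  hom_inv_id := Over.OverMorphism.ext hfg
  inv_hom_id := Over.OverMorphism.ext hgf

variable [MonoidalCategory M]

/-- The fibered tensor product on the slice over `q X`. -/
@[reducible]
noncomputable def sliceMonoidalStruct : MonoidalCategoryStruct (Over ((paramTerminal M).obj X)) where
  tensorObj A B := overMk ⟨{i : A.left.I × B.left.I // base A i.1 = base B i.2},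
    fun i => A.left.obj i.1.1 ⊗ B.left.obj i.1.2⟩ fun i => base A i.1.1
  tensorUnit := overMk ⟨X, fun _ => 𝟙_ M⟩ id
  whiskerLeft A _ _ g := overHom
    ⟨fun i => ⟨(i.1.1, g.left.f i.1.2), i.2.trans (base_left g _).symm⟩,
      fun i => A.left.obj i.1.1 ◁ g.left.φ i.1.2⟩ fun _ => rfl
  whiskerRight f B := overHom
    ⟨fun i => ⟨(f.left.f i.1.1, i.1.2), (base_left f _).trans i.2⟩,
      fun i => f.left.φ i.1.1 ▷ B.left.obj i.1.2⟩ fun _ => base_left f _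
  tensorHom f g := overHom
    ⟨fun i => ⟨(f.left.f i.1.1, g.left.f i.1.2),
        (base_left f _).trans (i.2.trans (base_left g _).symm)⟩,
      fun i => f.left.φ i.1.1 ⊗ₘ g.left.φ i.1.2⟩ fun _ => base_left f _
  associator A B C := overIso
    ⟨fun i => ⟨(i.1.1.1.1, ⟨(i.1.1.1.2, i.1.2), i.1.1.2.symm.trans i.2⟩), i.1.1.2⟩,
      fun i => (α_ (A.left.obj i.1.1.1.1) (B.left.obj i.1.1.1.2) (C.left.obj i.1.2)).hom⟩
    ⟨fun i => ⟨(⟨(i.1.1, i.1.2.1.1), i.2⟩, i.1.2.1.2), i.2.trans i.1.2.2⟩,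
      fun i => (α_ (A.left.obj i.1.1) (B.left.obj i.1.2.1.1) (C.left.obj i.1.2.1.2)).inv⟩
    (fun _ => rfl) (fun _ => rfl)
    (fam_hom_ext (fun _ => rfl) fun _ => heq_of_eq (Iso.hom_inv_id _))
    (fam_hom_ext (fun _ => rfl) fun _ => heq_of_eq (Iso.inv_hom_id _))
  leftUnitor A := overIso
    ⟨fun i => i.1.2, fun i => (λ_ (A.left.obj i.1.2)).hom⟩
    ⟨fun i => ⟨(base A i, i), rfl⟩, fun i => (λ_ (A.left.obj i)).inv⟩
    (fun i => i.2.symm) (fun _ => rfl)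
    -- The unit coordinate is forced by the fibre condition, and the component objects do not depend
    -- on it.
    (fam_hom_ext (fun i => Subtype.ext (Prod.ext i.2.symm rfl))
      fun _ => heq_of_eq (Iso.hom_inv_id _))
    (fam_hom_ext (fun _ => rfl) fun _ => heq_of_eq (Iso.inv_hom_id _))
  rightUnitor A := overIso
    ⟨fun i => i.1.1, fun i => (ρ_ (A.left.obj i.1.1)).hom⟩
    ⟨fun i => ⟨(i, base A i), rfl⟩, fun i => (ρ_ (A.left.obj i)).inv⟩
    (fun _ => rfl) (fun _ => rfl)
    (fam_hom_ext (fun i => Subtype.ext (Prod.ext rfl i.2))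
      fun _ => heq_of_eq (Iso.hom_inv_id _))
    (fam_hom_ext (fun _ => rfl) fun _ => heq_of_eq (Iso.inv_hom_id _))

attribute [local instance] sliceMonoidalStruct

/-- The fibered monoidal structure on the slice over `q X`. -/
@[reducible]
noncomputable def sliceMonoidal : MonoidalCategory (Over ((paramTerminal M).obj X)) where
  tensorHom_def _ _ := over_hom_ext (fun _ => rfl) fun _ =>
    heq_of_eq (MonoidalCategory.tensorHom_def _ _)
  id_tensorHom_id _ _ := over_hom_ext (fun _ => rfl) fun _ => heq_of_eq (id_tensorHom_id _ _)
  tensorHom_comp_tensorHom _ _ _ _ := over_hom_ext (fun _ => rfl) fun _ =>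
    heq_of_eq (tensorHom_comp_tensorHom _ _ _ _)
  whiskerLeft_id _ _ := over_hom_ext (fun _ => rfl) fun _ => heq_of_eq (whiskerLeft_id _ _)
  id_whiskerRight _ _ := over_hom_ext (fun _ => rfl) fun _ => heq_of_eq (id_whiskerRight _ _)
  associator_naturality _ _ _ := over_hom_ext (fun _ => rfl) fun _ =>
    heq_of_eq (associator_naturality _ _ _)
  leftUnitor_naturality _ := over_hom_ext (fun _ => rfl) fun _ => heq_of_eq (leftUnitor_naturality _)
  rightUnitor_naturality _ := over_hom_ext (fun _ => rfl) fun _ => heq_of_eq (rightUnitor_naturality _)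
  pentagon _ _ _ _ := over_hom_ext (fun _ => rfl) fun _ => heq_of_eq (pentagon _ _ _ _)
  triangle _ _ := over_hom_ext (fun _ => rfl) fun _ => heq_of_eq (triangle _ _)

attribute [local instance] sliceMonoidal

/-- The symmetry of the fibered tensor product. -/
@[reducible]
noncomputable def sliceSymmetric [SymmetricCategory M] :
    SymmetricCategory (Over ((paramTerminal M).obj X)) where
  braiding A B := overIso
    ⟨fun i => ⟨(i.1.2, i.1.1), i.2.symm⟩,
      fun i => (β_ (A.left.obj i.1.1) (B.left.obj i.1.2)).hom⟩
    ⟨fun i => ⟨(i.1.2, i.1.1), i.2.symm⟩,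
      fun i => (β_ (A.left.obj i.1.2) (B.left.obj i.1.1)).inv⟩
    (fun i => i.2.symm) (fun i => i.2.symm)
    (fam_hom_ext (fun _ => rfl) fun _ => heq_of_eq (Iso.hom_inv_id _))
    (fam_hom_ext (fun _ => rfl) fun _ => heq_of_eq (Iso.inv_hom_id _))
  braiding_naturality_right _ _ _ _ := over_hom_ext (fun _ => rfl) fun _ =>
    heq_of_eq (BraidedCategory.braiding_naturality_right _ _)
  braiding_naturality_left _ _ := over_hom_ext (fun _ => rfl) fun _ =>
    heq_of_eq (BraidedCategory.braiding_naturality_left _ _)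
  hexagon_forward _ _ _ := over_hom_ext (fun _ => rfl) fun _ =>
    heq_of_eq (BraidedCategory.hexagon_forward _ _ _)
  hexagon_reverse _ _ _ := over_hom_ext (fun _ => rfl) fun _ =>
    heq_of_eq (BraidedCategory.hexagon_reverse _ _ _)
  symmetry _ _ := over_hom_ext (fun _ => rfl) fun _ => heq_of_eq (SymmetricCategory.symmetry _ _)

/-- The forgetful functor from the slice is oplax monoidal, by the inclusions of the fibered
tensor products in the tensor products. -/
@[reducible]
noncomputable def forgetOplaxMonoidal :
    (Over.forget ((paramTerminal M).obj X)).OplaxMonoidal where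
  η := ⟨fun _ => PUnit.unit, fun _ => 𝟙 _⟩
  δ A B := ⟨fun i => i.1, fun _ => 𝟙 _⟩
  δ_natural_left f B := fam_hom_ext (fun _ => rfl) fun i => heq_of_eq
    ((Category.id_comp (f.left.φ i.1.1 ▷ B.left.obj i.1.2)).trans (Category.comp_id _).symm)
  δ_natural_right A f := fam_hom_ext (fun _ => rfl) fun i => heq_of_eq
    ((Category.id_comp (A.left.obj i.1.1 ◁ f.left.φ i.1.2)).trans (Category.comp_id _).symm)
  oplax_associativity A B C := fam_hom_ext (fun _ => rfl) fun i => heq_of_eq <| by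
    change 𝟙 _ ≫ 𝟙 _ ▷ _ ≫
        (α_ (A.left.obj i.1.1.1.1) (B.left.obj i.1.1.1.2) (C.left.obj i.1.2)).hom
      = (α_ (A.left.obj i.1.1.1.1) (B.left.obj i.1.1.1.2) (C.left.obj i.1.2)).hom ≫ 𝟙 _ ≫ _ ◁ 𝟙 _
    simp
  oplax_left_unitality A := fam_hom_ext (fun _ => rfl) fun i => heq_of_eq <| by
    change (λ_ (A.left.obj i)).inv = (λ_ (A.left.obj i)).inv ≫ 𝟙 _ ≫ 𝟙 _ ▷ _
    simp
  oplax_right_unitality A := fam_hom_ext (fun _ => rfl) fun i => heq_of_eq <| by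
    change (ρ_ (A.left.obj i)).inv = (ρ_ (A.left.obj i)).inv ≫ 𝟙 _ ≫ _ ◁ 𝟙 _
    simp

variable [MonoidalClosed M]

/-- The internal hom of families over `q X`. -/
noncomputable def sliceHom (A B : Over ((paramTerminal M).obj X)) :
    Over ((paramTerminal M).obj X) :=
  overMk ⟨Σ x : X, ({i // base A i = x} → {j // base B j = x}),
    fun s => ∏ᶜ fun i => (ihom (A.left.obj i.1)).obj (B.left.obj (s.2 i).1)⟩ Sigma.fst

/-- Uncurrying and currying back replaces the base point `s.1` by the base point of the source
index, and the two are only propositionally equal. With `x` a variable, the equality can be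
substituted, and `piCurry` cancels its inverse. -/
theorem piCurry_cast (A B : Over ((paramTerminal M).obj X)) (D : M) (x : X)
    (s : (sliceHom A B).left.I) (h : s.1 = x) (φ : D ⟶ (sliceHom A B).left.obj s) :
    (⟨⟨x, fun i => ⟨(s.2 ⟨i.1, i.2.trans h.symm⟩).1, (s.2 ⟨i.1, i.2.trans h.symm⟩).2.trans h⟩⟩,
      piCurry (fun i : {i // base A i = x} => A.left.obj i.1)
        (fun i => B.left.obj (s.2 ⟨i.1, i.2.trans h.symm⟩).1) D
        fun i => (piCurry (fun i : {i // base A i = s.1} => A.left.obj i.1)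
          (fun i => B.left.obj (s.2 i).1) D).symm φ ⟨i.1, i.2.trans h.symm⟩⟩ :
      Σ t, D ⟶ (sliceHom A B).left.obj t) = ⟨s, φ⟩ := by
  subst h
  exact Sigma.ext rfl (heq_of_eq ((piCurry (fun i : {i // base A i = s.1} => A.left.obj i.1)
          (fun i => B.left.obj (s.2 i).1) D).apply_symm_apply φ))

/-- Currying for families over `q X`. -/
noncomputable def sliceHomEquiv (A C B : Over ((paramTerminal M).obj X)) :
    ((tensorLeft A).obj C ⟶ B) ≃ (C ⟶ sliceHom A B) where
  toFun f := overHom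
    ⟨fun c => ⟨base C c, fun i => ⟨f.left.f ⟨(i.1, c), i.2⟩, (base_left f _).trans i.2⟩⟩,
      fun c => piCurry (fun i : {i // base A i = base C c} => A.left.obj i.1)
        (fun i => B.left.obj (f.left.f ⟨(i.1, c), i.2⟩)) (C.left.obj c)
        fun i => f.left.φ ⟨(i.1, c), i.2⟩⟩ fun _ => rfl
  invFun g := overHom
    ⟨fun i => ((g.left.f i.1.2).2 ⟨i.1.1, i.2.trans (base_left g i.1.2).symm⟩).1,
      fun i => (piCurry (fun j : {j // base A j = (g.left.f i.1.2).1} => A.left.obj j.1)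
        (fun j => B.left.obj ((g.left.f i.1.2).2 j).1) (C.left.obj i.1.2)).symm (g.left.φ i.1.2)
          ⟨i.1.1, i.2.trans (base_left g i.1.2).symm⟩⟩
    fun i => ((g.left.f i.1.2).2 _).2.trans ((base_left g i.1.2).trans i.2.symm)
  left_inv f := over_hom_ext (fun _ => rfl) fun i => heq_of_eq <|
    congrFun ((piCurry (fun j : {j // base A j = base C i.1.2} => A.left.obj j.1)
      (fun j => B.left.obj (f.left.f ⟨(j.1, i.1.2), j.2⟩)) (C.left.obj i.1.2)).symm_apply_apply
        (fun j => f.left.φ ⟨(j.1, i.1.2), j.2⟩ :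
          ∀ j : {j // base A j = base C i.1.2}, A.left.obj j.1 ⊗ C.left.obj i.1.2 ⟶
            B.left.obj (f.left.f ⟨(j.1, i.1.2), j.2⟩))) ⟨i.1.1, i.2⟩
  right_inv g := Over.OverMorphism.ext (fam_hom_ext_sigma fun c =>
    piCurry_cast A B (C.left.obj c) (base C c) (g.left.f c) (base_left g c) (g.left.φ c))

theorem sliceHomEquiv_naturality (A C' C B : Over ((paramTerminal M).obj X)) (f : C' ⟶ C)
    (g : (tensorLeft A).obj C ⟶ B) :
    sliceHomEquiv A C' B ((tensorLeft A).map f ≫ g) = f ≫ sliceHomEquiv A C B g := by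
  -- After uncurrying, the indices on both sides agree definitionally; in curried form the base
  -- points of an index and of its image under `f` would need a transport.
  obtain ⟨k, rfl⟩ := (sliceHomEquiv A C B).symm.surjective g
  rw [Equiv.apply_symm_apply, ← Equiv.eq_symm_apply]
  refine over_hom_ext (fun _ => rfl) fun i => heq_of_eq ?_
  exact (piCurry_symm_naturality
    (fun j : {j // base A j = (k.left.f (f.left.f i.1.2)).1} => A.left.obj j.1)
    (fun j => B.left.obj ((k.left.f (f.left.f i.1.2)).2 j).1) (f.left.φ i.1.2)
    (k.left.φ (f.left.f i.1.2))
    ⟨i.1.1, i.2.trans (base_left (f ≫ k) i.1.2).symm⟩).symm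

/-- The closed structure of the slice over `q X`. -/
@[reducible]
noncomputable def sliceClosed : MonoidalClosed (Over ((paramTerminal M).obj X)) where
  closed A :=
    ⟨_, Adjunction.adjunctionOfEquivRight (sliceHomEquiv A) (sliceHomEquiv_naturality A)⟩

end Slice

/-! ### Oplax structures determined by projections -/

section Projections

open CartesianMonoidalCategory (lift toUnit)
variable {C : Type u₁} [Category.{v₁} C] [MonoidalCategory C] {D : Type u₂} [Category.{v₂} D]
  [CartesianMonoidalCategory D]

/-- Natural projections `F (A ⊗ B) ⟶ F A` and `F (A ⊗ B) ⟶ F B` that are compatible with the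
structure isomorphisms. -/
structure TensorProjections (F : C ⥤ D) where
  left (A B : C) : F.obj (A ⊗ B) ⟶ F.obj A
  right (A B : C) : F.obj (A ⊗ B) ⟶ F.obj B
  left_whiskerRight {A A' : C} (f : A ⟶ A') (B : C) :
    left A B ≫ F.map f = F.map (f ▷ B) ≫ left A' B
  right_whiskerRight {A A' : C} (f : A ⟶ A') (B : C) :
    right A B = F.map (f ▷ B) ≫ right A' B
  left_whiskerLeft (A : C) {B B' : C} (f : B ⟶ B') :
    left A B = F.map (A ◁ f) ≫ left A B'
  right_whiskerLeft (A : C) {B B' : C} (f : B ⟶ B') :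
    right A B ≫ F.map f = F.map (A ◁ f) ≫ right A B'
  left_left (A B C : C) :
    left (A ⊗ B) C ≫ left A B = F.map (α_ A B C).hom ≫ left A (B ⊗ C)
  left_right (A B C : C) :
    left (A ⊗ B) C ≫ right A B = F.map (α_ A B C).hom ≫ right A (B ⊗ C) ≫ left B C
  right_eq (A B C : C) :
    right (A ⊗ B) C = F.map (α_ A B C).hom ≫ right A (B ⊗ C) ≫ right B C
  leftUnitor (A : C) : F.map (λ_ A).inv ≫ right (𝟙_ C) A = 𝟙 _
  rightUnitor (A : C) : F.map (ρ_ A).inv ≫ left A (𝟙_ C) = 𝟙 _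

/-- A functor to a cartesian monoidal category with projections is oplax monoidal. -/
@[reducible]
def TensorProjections.oplaxMonoidal {F : C ⥤ D} (p : TensorProjections F) : F.OplaxMonoidal where
  η := toUnit _
  δ A B := lift (p.left A B) (p.right A B)
  δ_natural_left f B := by
    apply CartesianMonoidalCategory.hom_ext
    · simp [p.left_whiskerRight]
    · simp [← p.right_whiskerRight]
  δ_natural_right A f := by
    apply CartesianMonoidalCategory.hom_ext
    · simp [← p.left_whiskerLeft]
    · simp [p.right_whiskerLeft]
  oplax_associativity A B C := by
    apply CartesianMonoidalCategory.hom_ext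
    · simp [p.left_left]
    apply CartesianMonoidalCategory.hom_ext
    · simp [p.left_right]
    · simp [← p.right_eq]
  oplax_left_unitality A := by
    apply CartesianMonoidalCategory.hom_ext
    · exact CartesianMonoidalCategory.toUnit_unique _ _
    · simp [p.leftUnitor]
  oplax_right_unitality A := by
    apply CartesianMonoidalCategory.hom_ext
    · simp [p.rightUnitor]
    · exact CartesianMonoidalCategory.toUnit_unique _ _

end Projections

/-! ### The strong monoidal functor to sets over `X` -/

section Slice

variable {M : Type u} [Category.{v} M] [HasProducts.{v} M] {X : Type v}
variable [MonoidalCategory M]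

attribute [local instance] Over.cartesianMonoidalCategory Over.braidedCategory
  sliceMonoidal sliceSymmetric forgetOplaxMonoidal

open CartesianMonoidalCategory (lift toUnit)

variable (M X) in
/-- The functor from the slice over `q X` to the slice over `X`. -/
noncomputable abbrev slicePost : Over ((paramTerminal M).obj X) ⥤
    Over ((sharp M).obj ((paramTerminal M).obj X)) :=
  Over.post (sharp M)

/-- The first projection from the index set of a fibered tensor product. -/
noncomputable def slicePostFst (A B : Over ((paramTerminal M).obj X)) :
    (slicePost M X).obj (A ⊗ B) ⟶ (slicePost M X).obj A :=
  Over.homMk (↾fun i : {i : A.left.I × B.left.I // base A i.1 = base B i.2} => i.1.1) rfl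

/-- The second projection from the index set of a fibered tensor product. -/
noncomputable def slicePostSnd (A B : Over ((paramTerminal M).obj X)) :
    (slicePost M X).obj (A ⊗ B) ⟶ (slicePost M X).obj B :=
  Over.homMk (↾fun i : {i : A.left.I × B.left.I // base A i.1 = base B i.2} => i.1.2) (by
    ext i
    exact i.2.symm)

variable (M X) in
/-- The projections from the index set of a fibered tensor product. -/
noncomputable def sliceProjections : TensorProjections (slicePost M X) where
  left := slicePostFst
  right := slicePostSnd
  left_whiskerRight _ _ := rfl
  right_whiskerRight _ _ := rfl
  left_whiskerLeft _ _ _ _ := rfl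
  right_whiskerLeft _ _ _ _ := rfl
  left_left _ _ _ := rfl
  left_right _ _ _ := rfl
  right_eq _ _ _ := rfl
  leftUnitor _ := rfl
  rightUnitor _ := rfl

/-- This identifies `δ` with the standard bijection from compatible pairs to the abstract pullback,
whence its invertibility. -/
theorem slicePost_lift_left (A B : Over ((paramTerminal M).obj X)) :
    (lift (slicePostFst A B) (slicePostSnd A B)).left =
      (Types.pullbackIsoPullback ((sharp M).map A.hom) ((sharp M).map B.hom)).inv := by
  refine pullback.hom_ext (f := (sharp M).map A.hom) (g := (sharp M).map B.hom) ?_ ?_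
  · refine Eq.trans ?_ (Types.pullbackIsoPullback_inv_fst
      ((sharp M).map A.hom) ((sharp M).map B.hom)).symm
    exact congrArg CommaMorphism.left
      (CartesianMonoidalCategory.lift_fst (slicePostFst A B) (slicePostSnd A B))
  · refine Eq.trans ?_ (Types.pullbackIsoPullback_inv_snd
      ((sharp M).map A.hom) ((sharp M).map B.hom)).symm
    exact congrArg CommaMorphism.left
      (CartesianMonoidalCategory.lift_snd (slicePostFst A B) (slicePostSnd A B))

instance (A B : Over ((paramTerminal M).obj X)) :
    IsIso (lift (slicePostFst A B) (slicePostSnd A B)) := by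
  have : IsIso ((Over.forget _).map (lift (slicePostFst A B) (slicePostSnd A B))) := by
    rw [Over.forget_map, slicePost_lift_left]
    exact Iso.isIso_inv _
  exact isIso_of_reflects_iso _ (Over.forget _)

instance :
    IsIso (toUnit ((slicePost M X).obj (𝟙_ (Over ((paramTerminal M).obj X))))) := by
  refine ⟨Over.homMk (𝟙 X) rfl, ?_, CartesianMonoidalCategory.toUnit_unique _ _⟩
  rfl

/-- The functor from the slice over `q X` to the slice over `X` is strong monoidal. -/
@[reducible]
noncomputable def slicePostMonoidal : (slicePost M X).Monoidal :=
  letI := (sliceProjections M X).oplaxMonoidal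
  haveI : IsIso (Functor.OplaxMonoidal.η (slicePost M X)) :=
    inferInstanceAs (IsIso (toUnit _))
  haveI : ∀ A B, IsIso (Functor.OplaxMonoidal.δ (slicePost M X) A B) :=
    fun A B => inferInstanceAs (IsIso (lift (slicePostFst A B) (slicePostSnd A B)))
  .ofOplaxMonoidal _

attribute [local instance] slicePostMonoidal

theorem slicePost_δ (A B : Over ((paramTerminal M).obj X)) :
    Functor.OplaxMonoidal.δ (slicePost M X) A B = lift (slicePostFst A B) (slicePostSnd A B) :=
  rfl

variable [SymmetricCategory M]

/-- The functor from the slice over `q X` to the slice over `X` is braided. -/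
@[reducible]
noncomputable def slicePostBraided : (slicePost M X).Braided where
  braided A B := by
    -- Composing with the isomorphisms `δ` on both sides eliminates `μ`; the pairings that remain
    -- are compared by projections.
    rw [← cancel_epi (Functor.OplaxMonoidal.δ (slicePost M X) A B),
      Functor.Monoidal.δ_μ_assoc, ← Category.assoc,
      ← cancel_mono (Functor.OplaxMonoidal.δ (slicePost M X) B A), Category.assoc,
      Category.assoc, Functor.Monoidal.μ_δ, Category.comp_id, slicePost_δ, slicePost_δ]
    apply CartesianMonoidalCategory.hom_ext
    · simp only [Category.assoc, CartesianMonoidalCategory.lift_fst,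
        CartesianMonoidalCategory.braiding_hom_fst,
        CartesianMonoidalCategory.lift_snd]
      rfl
    · simp only [Category.assoc, CartesianMonoidalCategory.lift_fst,
        CartesianMonoidalCategory.braiding_hom_snd,
        CartesianMonoidalCategory.lift_snd]
      rfl

end Slice

/-! ### Preservation of fibered internal homs -/

section SliceClosed

variable {M : Type u} [Category.{v} M] [HasProducts.{v} M] {X : Type v}

theorem over_w_apply {A : Over X} {B : Over ((paramTerminal M).obj X)}
    (g : A ⟶ (slicePost M X).obj B) (i : A.left) :
    base B (g.left i) = A.hom i :=
  ConcreteCategory.congr_hom (Over.w g) i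

variable [MonoidalCategory M]

attribute [local instance] Over.cartesianMonoidalCategory Over.braidedCategory
  sliceMonoidal sliceSymmetric forgetOplaxMonoidal slicePostMonoidal

open CartesianMonoidalCategory (lift toUnit)

theorem map_forget_δ (A B : Over ((paramTerminal M).obj X)) :
    (sharp M).map (Functor.OplaxMonoidal.δ (Over.forget ((paramTerminal M).obj X)) A B) ≫
        Functor.OplaxMonoidal.δ (sharp M) A.left B.left =
      (Functor.OplaxMonoidal.δ (slicePost M X) A B).left ≫
        lift (pullback.fst ((sharp M).map A.hom) ((sharp M).map B.hom))
          (pullback.snd ((sharp M).map A.hom) ((sharp M).map B.hom)) := by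
  rw [slicePost_δ]
  apply CartesianMonoidalCategory.hom_ext
  · exact (congrArg CommaMorphism.left
      (CartesianMonoidalCategory.lift_fst (slicePostFst A B) (slicePostSnd A B))).symm
  · exact (congrArg CommaMorphism.left
      (CartesianMonoidalCategory.lift_snd (slicePostFst A B) (slicePostSnd A B))).symm

theorem isCartesianArrow_forget_δ (A B : Over ((paramTerminal M).obj X)) :
    IsCartesianArrow (sharp M)
      (Functor.OplaxMonoidal.δ (Over.forget ((paramTerminal M).obj X)) A B) :=
  (isCartesianArrow_iff _).2 fun _ => inferInstanceAs (IsIso (𝟙 _))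

variable (M X) in
theorem isCartesianArrow_forget_η :
    IsCartesianArrow (sharp M)
      (Functor.OplaxMonoidal.η (Over.forget ((paramTerminal M).obj X))) :=
  (isCartesianArrow_iff _).2 fun _ => inferInstanceAs (IsIso (𝟙 _))

variable (M) in
/-- The family of units over a set over `X`. -/
noncomputable abbrev overUnits (Z : Over ((sharp M).obj ((paramTerminal M).obj X))) :
    Over ((paramTerminal M).obj X) :=
  overMk ⟨Z.left, fun _ => 𝟙_ M⟩ Z.hom

variable [MonoidalClosed M]

/-- Comparing both functions on the fibre over a common `x` avoids transporting one along `s.1 =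
s'.1`. -/
theorem sliceHom_index_ext {A B : Over ((paramTerminal M).obj X)} {x : X}
    {s s' : (sliceHom A B).left.I} (h : s.1 = x) (h' : s'.1 = x)
    (H : ∀ a (ha : base A a = x),
      (s.2 ⟨a, ha.trans h.symm⟩).1 = (s'.2 ⟨a, ha.trans h'.symm⟩).1) : s = s' := by
  obtain ⟨y, s⟩ := s
  obtain ⟨y', s'⟩ := s'
  obtain rfl : y = x := h
  obtain rfl : y' = y := h'
  obtain rfl : s = s' := funext fun a => Subtype.ext (H a.1 a.2)
  rfl

/-- The index function of the arrow obtained from `g` by uncurrying. -/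
noncomputable def sliceUncurry {A B : Over ((paramTerminal M).obj X)}
    {Z : Over ((sharp M).obj ((paramTerminal M).obj X))}
    (g : (slicePost M X).obj (overUnits M Z) ⟶ (slicePost M X).obj (sliceHom A B)) :
    (slicePost M X).obj (A ⊗ overUnits M Z) ⟶ (slicePost M X).obj B :=
  Over.homMk (↾fun i : {i : A.left.I × Z.left // base A i.1 = Z.hom i.2} =>
    (Sigma.snd (g.left i.1.2) ⟨i.1.1, i.2.trans (over_w_apply g i.1.2).symm⟩).1) (by
    ext i
    exact ((Sigma.snd (g.left i.1.2) _).2.trans (over_w_apply g i.1.2)).trans i.2.symm)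

theorem bijective_sliceUncurry (A B : Over ((paramTerminal M).obj X))
    (Z : Over ((sharp M).obj ((paramTerminal M).obj X))) :
    Function.Bijective
      fun g : (slicePost M X).obj (overUnits M Z) ⟶ (slicePost M X).obj (sliceHom A B) =>
        sliceUncurry g := by
  constructor
  · intro g g' h
    apply Over.OverMorphism.ext
    ext z
    refine sliceHom_index_ext (over_w_apply g z) (over_w_apply g' z) fun a ha => ?_
    exact ConcreteCategory.congr_hom (congrArg CommaMorphism.left h)
      (⟨(a, z), ha⟩ : {i : A.left.I × Z.left // base A i.1 = Z.hom i.2})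
  · intro k
    refine ⟨Over.homMk (↾fun z => (⟨Z.hom z, fun a => ⟨k.left
      (⟨(a.1, z), a.2⟩ : {i : A.left.I × Z.left // base A i.1 = Z.hom i.2}),
        (over_w_apply k _).trans a.2⟩⟩ : (sliceHom A B).left.I)) rfl, rfl⟩

attribute [local instance] sliceClosed

/-- Precomposition with `δ` replaces the abstract pullback by compatible pairs, where the map is an
explicit function. -/
theorem δ_comp_uncurry {A B : Over ((paramTerminal M).obj X)}
    {Z : Over ((sharp M).obj ((paramTerminal M).obj X))}
    (g : (slicePost M X).obj (overUnits M Z) ⟶ (slicePost M X).obj ((ihom A).obj B)) :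
    Functor.OplaxMonoidal.δ (slicePost M X) A (overUnits M Z) ≫
      (slicePost M X).obj A ◁ g ≫ Functor.LaxMonoidal.μ (slicePost M X) A ((ihom A).obj B) ≫
        (slicePost M X).map ((ihom.ev A).app B) = sliceUncurry g := by
  -- The whiskering `A ◁ g`, written on compatible pairs. `g` need not come from an arrow of
  -- families, so naturality of `δ` does not supply `hh`.
  let h : (slicePost M X).obj (A ⊗ overUnits M Z) ⟶
      (slicePost M X).obj (A ⊗ (ihom A).obj B) :=
    Over.homMk (↾fun i : {i : A.left.I × Z.left // base A i.1 = Z.hom i.2} =>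
      (⟨(i.1.1, g.left i.1.2), i.2.trans (over_w_apply g i.1.2).symm⟩ :
        {i : A.left.I × ((ihom A).obj B).left.I // base A i.1 = base ((ihom A).obj B) i.2})) rfl
  have hh : Functor.OplaxMonoidal.δ (slicePost M X) A (overUnits M Z) ≫ (slicePost M X).obj A ◁ g =
      h ≫ Functor.OplaxMonoidal.δ (slicePost M X) A ((ihom A).obj B) := by
    have h₁ : h ≫ slicePostFst A ((ihom A).obj B) = slicePostFst A (overUnits M Z) := rfl
    have h₂ : h ≫ slicePostSnd A ((ihom A).obj B) = slicePostSnd A (overUnits M Z) ≫ g := rfl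
    rw [slicePost_δ, slicePost_δ, CartesianMonoidalCategory.lift_whiskerLeft,
      CartesianMonoidalCategory.comp_lift, h₁, h₂]
  rw [reassoc_of% hh, Functor.Monoidal.δ_μ_assoc]
  rfl

variable (M X) in
theorem preservesInternalHom_slicePost : PreservesInternalHom (slicePost M X) := by
  intro A B Z
  have h := bijective_sliceUncurry A B Z
  let e : (slicePost M X).obj (A ⊗ overUnits M Z) ≅
      (slicePost M X).obj A ⊗ (slicePost M X).obj (overUnits M Z) :=
    (Functor.Monoidal.μIso (slicePost M X) A (overUnits M Z)).symm
  -- Precomposition with the isomorphism `δ` is bijective, so bijectivity can be tested after it.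
  refine (Function.Bijective.of_comp_iff'
    (e.homFromEquiv (Z := (slicePost M X).obj B)).symm.bijective _).1 ?_
  exact (congrArg Function.Bijective (funext fun g => δ_comp_uncurry g)).mpr h

end SliceClosed

/-! ### Local cartesian closure of sets and assembly -/

section Main

variable {M : Type u} [Category.{v} M] [HasProducts.{v} M]
variable [MonoidalCategory M] [MonoidalClosed M]

attribute [local instance] Over.cartesianMonoidalCategory Over.braidedCategory

attribute [local instance] sliceMonoidal slicePostMonoidal sliceClosed in
variable (M) in
/-- Uncurrying in a slice of the category of sets. -/
noncomputable def overTypeHomEquiv {X : Type v} (A Z B : Over X) :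
    (A ⊗ Z ⟶ B) ≃ (Z ⟶ (slicePost M X).obj ((ihom (overUnits M A)).obj (overUnits M B))) :=
  (Equiv.ofBijective _ (preservesInternalHom_slicePost M X (overUnits M A) (overUnits M B) Z)).symm

theorem overTypeHomEquiv_naturality {X : Type v} (A Z' Z B : Over X) (f : Z' ⟶ Z)
    (g : A ⊗ Z ⟶ B) :
    overTypeHomEquiv M A Z' B (A ◁ f ≫ g) = f ≫ overTypeHomEquiv M A Z B g := by
  obtain ⟨k, rfl⟩ := (overTypeHomEquiv M A Z B).symm.surjective g
  rw [Equiv.apply_symm_apply, ← Equiv.eq_symm_apply]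
  refine Eq.trans ?_ (congrArg (· ≫ _) (MonoidalCategory.whiskerLeft_comp A f k)).symm
  exact (Category.assoc _ _ _).symm

/-- `M` serves only to present sets over `X` as families of units; the index sets of their internal
homs over `q X` are the exponentials. -/
theorem isLocallyCartesianClosed_type (M : Type u) [Category.{v} M] [HasProducts.{v} M]
    [MonoidalCategory M] [MonoidalClosed M] : IsLocallyCartesianClosed (Type v) :=
  ⟨inferInstance, fun _ => ⟨⟨fun A => ⟨_, Adjunction.adjunctionOfEquivRight
    (F := tensorLeft A) (overTypeHomEquiv M A) (overTypeHomEquiv_naturality A)⟩⟩⟩⟩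

variable [SymmetricCategory M]

attribute [local instance] sliceMonoidal sliceSymmetric sliceClosed forgetOplaxMonoidal
  slicePostMonoidal slicePostBraided in
variable (M) in
/-- The fibered symmetric monoidal closed structure on the slice over `q X`. -/
noncomputable def sliceFiberedMonoidalClosed (X : Type v) :
    FiberedMonoidalClosed (sharp M) ((paramTerminal M).obj X) where
  monoidal := sliceMonoidal
  symmetric := sliceSymmetric
  closed := sliceClosed
  forget := forgetOplaxMonoidal
  forget_braiding A B := fam_hom_ext (fun _ => rfl) fun i => heq_of_eq
    ((Category.comp_id (β_ (A.left.obj i.1.1) (B.left.obj i.1.2)).hom).trans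
      (Category.id_comp _).symm)
  δ_cartesian := isCartesianArrow_forget_δ
  η_cartesian := isCartesianArrow_forget_η M X
  post := slicePostBraided
  map_δ := map_forget_δ
  preservesInternalHom := preservesInternalHom_slicePost M X

end Main

end StateParameter

theorem mainTheorem5 (M : Type u) [Category.{v} M] [MonoidalCategory M]
    [SymmetricCategory M] [MonoidalClosed M] [HasProducts.{v} M] :
    ∃ _ : MonoidalClosed (StateParameter.Fam.{v} M),
      (∀ A B : StateParameter.Fam.{v} M,
        Nonempty ((ihom A).obj B ≅ StateParameter.famHom A B)) ∧
      StateParameter.IsStateParameterFibration (StateParameter.sharp M)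
        (StateParameter.paramTerminal M) (StateParameter.paramUnit M) :=
  letI := StateParameter.famClosed (M := M)
  ⟨this, fun _ _ => ⟨Iso.refl _⟩,
    { isPullbackFibration := StateParameter.isPullbackFibration_sharp
      isLocallyCartesianClosed := StateParameter.isLocallyCartesianClosed_type M
      isParameterizedTerminal := StateParameter.isParameterizedTerminal_paramTerminal
      isParameterizedUnit := StateParameter.isParameterizedUnit_paramUnit
      preservesInternalHom := StateParameter.preservesInternalHom_sharp
      tensor_cartesian := StateParameter.tensor_isCartesianArrow
      fiberedMonoidalClosed := fun X => ⟨StateParameter.sliceFiberedMonoidalClosed M X⟩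
      isLeftAdjoint := StateParameter.isLeftAdjoint_paramUnit }⟩
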